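/- Let $S\ge 2$ and $n\ge 1$ be integers, and let $\mathcal{M}_S$ be the set of all probability vectors $P=(p_1,\dots,p_S)$, i.e. $p_i\ge 0$ and $\sum_{i=1}^S p_i=1$. For $P\in\mathcal{M}_S$ let $\mathbb{E}_P$ denote expectation over $n$ independent samples drawn from $P$. An estimator $\hat P$ is any function of the $n$ samples with values in $\mathbb{R}^S$ (not necessarily a probability vector), and $\|\hat P-P\|_1=\sum_{i=1}^S|\hat p_i-p_i|$. Then, for every $\zeta\in(0,1]$, $$\inf_{\hat{P}}\sup_{P\in\mathcal{M}_S} \mathbb{E}_P\|\hat{P}-P\|_1 \;\ge\; \frac{1}{8}\sqrt{\frac{eS}{(1+\zeta)n}}\;\mathbb{1}\!\left(\frac{(1+\zeta)n}{S}> \frac{e}{16}\right) + \exp\left(-\frac{2(1+\zeta)n}{S}\right)\mathbb{1}\!\left(\frac{(1+\zeta)n}{S}\le \frac{e}{16}\right) - \exp\left(-\frac{\zeta^2n}{24}\right) - 12\exp\left(-\frac{\zeta^2S}{32(\ln S)^2}\right),$$ where the infimum is taken over all estimators and $\ln$ is the natural logarithm. -/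

import Mathlib

noncomputable section

namespace DiscreteEstimation

/-- The set of all probability vectors `(p_1, …, p_S)` on an alphabet with `S` symbols. -/
def distributions (S : ℕ) : Set (Fin S → ℝ) :=
  {p | (∀ i, 0 ≤ p i) ∧ ∑ i, p i = 1}

/-- The `ℓ₁` loss `‖p - q‖₁`; the vector `q` need not be a probability vector. -/
def l1Loss {S : ℕ} (p q : Fin S → ℝ) : ℝ := ∑ i, |p i - q i|

/-- The probability of observing the sequence `x = (x_1, …, x_n)` when `x_1, …, x_n` are
independent with common law `p`. -/
def sampleProb {S n : ℕ} (p : Fin S → ℝ) (x : Fin n → Fin S) : ℝ := ∏ j, p (x j)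

/-- An estimator based on `n` samples from an alphabet with `S` symbols: an arbitrary function of
the samples with values in `ℝ^S` (not necessarily a probability vector). Every function of the
vector of counts is in particular such a function. -/
abbrev Estimator (S n : ℕ) : Type := (Fin n → Fin S) → Fin S → ℝ

/-- The risk `E_p ‖P̂ - p‖₁` of the estimator `P̂`, the expectation being over `n` independent
samples from `p` (a finite sum, as there are finitely many possible samples). -/
def risk {S n : ℕ} (p : Fin S → ℝ) (est : Estimator S n) : ℝ :=
  ∑ x : Fin n → Fin S, sampleProb p x * l1Loss p (est x)

/-- The maximum risk of an estimator over all probability vectors on `S` symbols. -/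
def maxRisk {S n : ℕ} (est : Estimator S n) : ℝ :=
  ⨆ p : distributions S, risk p.1 est

/-- The minimax risk over all probability vectors on `S` symbols, with `n` samples. -/
def minimaxRisk (S n : ℕ) : ℝ :=
  ⨅ est : Estimator S n, maxRisk est

/-- The sample probabilities add up to one. -/
theorem sum_sampleProb {S n : ℕ} {p : Fin S → ℝ} (hp : p ∈ distributions S) :
    ∑ x : Fin n → Fin S, sampleProb p x = 1 := by
  unfold sampleProb
  rw [← Fintype.prod_sum (fun (_ : Fin n) (i : Fin S) => p i)]
  simp [hp.2]

theorem risk_nonneg {S n : ℕ} {p : Fin S → ℝ} (hp : p ∈ distributions S)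
    (est : Estimator S n) : 0 ≤ risk p est :=
  Finset.sum_nonneg fun _ _ => mul_nonneg (Finset.prod_nonneg fun _ _ => hp.1 _)
    (Finset.sum_nonneg fun _ _ => abs_nonneg _)

/-- The supremum in `maxRisk` is taken over a bounded set of reals. -/
theorem bddAbove_risk {S n : ℕ} (est : Estimator S n) :
    BddAbove (Set.range fun p : distributions S => risk p.1 est) := by
  refine ⟨∑ x : Fin n → Fin S, ∑ i, (1 + |est x i|), ?_⟩
  rintro _ ⟨⟨p, hp⟩, rfl⟩
  have h1 : ∀ i, p i ≤ 1 := fun i => hp.2 ▸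
    Finset.single_le_sum (f := p) (fun i _ => hp.1 i) (Finset.mem_univ i)
  refine Finset.sum_le_sum fun x _ => ?_
  have hl : l1Loss p (est x) ≤ ∑ i, (1 + |est x i|) := Finset.sum_le_sum fun i _ =>
    (abs_sub _ _).trans (by rw [abs_of_nonneg (hp.1 i)]; linarith [h1 i])
  have hl0 : 0 ≤ l1Loss p (est x) := Finset.sum_nonneg fun _ _ => abs_nonneg _
  have hs : sampleProb p x ≤ 1 := Finset.prod_le_one (fun _ _ => hp.1 _) fun _ _ => h1 _
  exact (mul_le_of_le_one_left hl0 hs).trans hl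

/-- The infimum in `minimaxRisk` is taken over a set of reals that is bounded below. -/
theorem bddBelow_maxRisk (S n : ℕ) :
    BddBelow (Set.range fun est : Estimator S n => maxRisk est) :=
  ⟨0, by
    rintro _ ⟨est, rfl⟩
    exact Real.iSup_nonneg fun p => risk_nonneg p.2 est⟩

end DiscreteEstimation

end

/-!
The minimax risk is bounded below by the average risk over a cube of distributions indexed by sign
patterns `σ : Fin m → Bool`, in the manner of Assouad: if flipping the bit `i` moves the
distribution by `d` in a share of the `ℓ₁` loss that belongs to `i`, then the risks at `σ` and at
its neighbour add up, on that share, to at least `d` times `∑ min (P x) (Q x)`, the total mass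
common to the two laws of the sample (`assouad`). Only patterns in a set `G` need to give
probability vectors, which costs a factor equal to the fraction of patterns all of whose
neighbours also lie in `G`.

Two cubes are used, according to the size of `x = (1 + ζ) n / S`.

* For `x ≤ 1/2` the symbols are matched into `m = ⌊S/2⌋` pairs, and `σ` chooses which symbol of
  each pair carries its whole mass `1 / m`. Neighbouring laws agree on samples that miss the pair,
  so the risk is at least `(1 - 1/m) ^ n` (`pow_le_minimaxRisk`). This exceeds `exp (-2x)`, and
  for `e/16 < x ≤ 1/2` the latter dominates `(1/8) √(e/x)` (`sqrt_le_exp_neg`).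
* For `x ≥ 1/2` all symbols but one get probability `a (1 ± η)`, with `η = (1/4) √(e/x)`, and the
  last symbol is a buffer that restores total mass one. By Chebyshev's inequality the buffer stays
  well above zero for most sign patterns, so that it reveals almost nothing about a single sign.
  The common mass of neighbouring laws is controlled by their Hellinger affinity, which
  factorizes over samples (`perturbed_le_minimaxRisk`, `half_le_minimaxRisk`).

The claimed bound is at most `1 - 12 exp (-ζ² S / (32 (ln S)²))`, so it is trivial unless
`ζ² S` is large; `le_sq_mul_of_error_lt_one` gives `ζ² S ≥ 4915`. This makes a relative change
of the total mass by a small multiple of `ζ` big enough for the buffer and for rounding.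
-/

noncomputable section

namespace DiscreteEstimation

variable {S n m : ℕ}

/-! ### Assouad's lemma -/

/-- The neighbour of `σ` in the cube `Fin m → Bool` obtained by negating its `i`-th bit. -/
def flipBit (i : Fin m) (σ : Fin m → Bool) : Fin m → Bool := Function.update σ i (!σ i)

@[simp] theorem flipBit_same (i : Fin m) (σ : Fin m → Bool) : flipBit i σ i = !σ i := by simp [flipBit]

theorem flipBit_of_ne {i j : Fin m} (h : j ≠ i) (σ : Fin m → Bool) : flipBit i σ j = σ j := by
  simp [flipBit, h]

theorem flipBit_involutive (i : Fin m) : Function.Involutive (flipBit i) := fun σ => by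
  simp [flipBit]

theorem sum_flipBit (i : Fin m) (f : (Fin m → Bool) → ℝ) : ∑ σ, f (flipBit i σ) = ∑ σ, f σ :=
  Equiv.sum_comp (flipBit_involutive i).toPerm f

theorem sampleProb_nonneg {p : Fin S → ℝ} (hp : ∀ i, 0 ≤ p i) (x : Fin n → Fin S) :
    0 ≤ sampleProb p x :=
  Finset.prod_nonneg fun _ _ => hp _

theorem le_minimaxRisk {c : ℝ} (h : ∀ est : Estimator S n, c ≤ maxRisk est) :
    c ≤ minimaxRisk S n :=
  le_ciInf h

theorem minimaxRisk_nonneg : 0 ≤ minimaxRisk S n :=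
  le_minimaxRisk fun _ => Real.iSup_nonneg fun p => risk_nonneg p.2 _

/-- Assouad's lemma on part of the cube. The family `p` consists of probability vectors on `G`,
and `C` is a set of patterns that lie in `G` together with all their neighbours. The function
`l i` is the share of the loss attributed to the bit `i`, and `A` bounds from below the mass common
to the laws of the sample under neighbouring vectors. -/
theorem assouad (p : (Fin m → Bool) → Fin S → ℝ) (G C : Finset (Fin m → Bool))
    (hp : ∀ σ ∈ G, p σ ∈ distributions S) (hCG : C ⊆ G)
    (hflip : ∀ σ ∈ C, ∀ i, flipBit i σ ∈ G)
    (l : Fin m → (Fin m → Bool) → (Fin S → ℝ) → ℝ) (hl : ∀ i σ q, 0 ≤ l i σ q)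
    (hsum : ∀ σ q, ∑ i, l i σ q ≤ l1Loss (p σ) q)
    {d A : ℝ} (hd : 0 ≤ d) (hsep : ∀ i σ q, d ≤ l i σ q + l i (flipBit i σ) q)
    (hA : ∀ σ ∈ C, ∀ i, A ≤ ∑ x : Fin n → Fin S,
      min (sampleProb (p σ) x) (sampleProb (p (flipBit i σ)) x))
    (est : Estimator S n) :
    m * (d * A) / 2 * C.card ≤ 2 ^ m * maxRisk est := by
  classical
  -- the share of the risk attributed to the bit `i`, set to zero off `G`
  set r : Fin m → (Fin m → Bool) → ℝ := fun i σ =>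
    if σ ∈ G then ∑ x : Fin n → Fin S, sampleProb (p σ) x * l i σ (est x) else 0 with hr
  have hr0 : ∀ i σ, 0 ≤ r i σ := by
    intro i σ
    simp only [hr]
    split_ifs with h
    · exact Finset.sum_nonneg fun x _ => mul_nonneg (sampleProb_nonneg (hp σ h).1 x) (hl _ _ _)
    · exact le_rfl
  have hR0 : 0 ≤ maxRisk est := Real.iSup_nonneg fun p => risk_nonneg p.2 est
  have hrisk : ∀ σ, ∑ i, r i σ ≤ maxRisk est := by
    intro σ
    by_cases h : σ ∈ G
    · simp only [hr, if_pos h]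
      rw [Finset.sum_comm]
      refine le_trans ?_ (le_ciSup (bddAbove_risk est) ⟨p σ, hp σ h⟩)
      refine Finset.sum_le_sum fun x _ => ?_
      rw [← Finset.mul_sum]
      exact mul_le_mul_of_nonneg_left (hsum _ _) (sampleProb_nonneg (hp σ h).1 x)
    · simpa [hr, h] using hR0
  have hpair : ∀ i, ∀ σ ∈ C, d * A ≤ r i σ + r i (flipBit i σ) := by
    intro i σ hσ
    have h1 := hCG hσ
    have h2 := hflip σ hσ i
    simp only [hr, if_pos h1, if_pos h2]
    rw [← Finset.sum_add_distrib]
    refine (mul_le_mul_of_nonneg_left (hA σ hσ i) hd).trans ?_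
    rw [Finset.mul_sum]
    refine Finset.sum_le_sum fun x _ => ?_
    have hP := sampleProb_nonneg (hp _ h1).1 x
    have hQ := sampleProb_nonneg (hp _ h2).1 x
    calc d * min (sampleProb (p σ) x) (sampleProb (p (flipBit i σ)) x)
        ≤ (l i σ (est x) + l i (flipBit i σ) (est x)) *
            min (sampleProb (p σ) x) (sampleProb (p (flipBit i σ)) x) :=
          mul_le_mul_of_nonneg_right (hsep _ _ _) (le_min hP hQ)
      _ ≤ _ := by
          rw [add_mul, mul_comm (l i σ (est x)), mul_comm (l i (flipBit i σ) (est x))]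
          exact add_le_add
            (mul_le_mul_of_nonneg_right (min_le_left _ _) (hl _ _ _))
            (mul_le_mul_of_nonneg_right (min_le_right _ _) (hl _ _ _))
  have hcoord : ∀ i, d * A / 2 * C.card ≤ ∑ σ, r i σ := by
    intro i
    have h1 : C.card • (d * A) ≤ ∑ σ ∈ C, (r i σ + r i (flipBit i σ)) :=
      Finset.card_nsmul_le_sum _ _ _ (hpair i)
    have h2 : ∑ σ ∈ C, (r i σ + r i (flipBit i σ)) ≤ ∑ σ, (r i σ + r i (flipBit i σ)) :=
      Finset.sum_le_univ_sum_of_nonneg fun σ => add_nonneg (hr0 _ _) (hr0 _ _)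
    rw [Finset.sum_add_distrib (s := Finset.univ), sum_flipBit] at h2
    rw [nsmul_eq_mul] at h1
    linarith
  calc m * (d * A) / 2 * C.card = ∑ _i : Fin m, d * A / 2 * C.card := by simp; ring
    _ ≤ ∑ i, ∑ σ, r i σ := Finset.sum_le_sum fun i _ => hcoord i
    _ = ∑ σ, ∑ i, r i σ := Finset.sum_comm
    _ ≤ ∑ _σ : Fin m → Bool, maxRisk est := Finset.sum_le_sum fun σ _ => hrisk σ
    _ = 2 ^ m * maxRisk est := by simp

/-! ### Mass common to two laws of the sample -/

theorem pow_sum_le_sum_min_sampleProb {p q w : Fin S → ℝ} (hw : ∀ j, 0 ≤ w j)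
    (hwp : ∀ j, w j ≤ p j) (hwq : ∀ j, w j ≤ q j) :
    (∑ j, w j) ^ n ≤ ∑ x : Fin n → Fin S, min (sampleProb p x) (sampleProb q x) := by
  have : (∑ j, w j) ^ n = ∑ x : Fin n → Fin S, sampleProb w x := by
    unfold sampleProb
    rw [← Fintype.prod_sum (fun (_ : Fin n) (i : Fin S) => w i)]
    simp
  rw [this]
  refine Finset.sum_le_sum fun x _ => le_min ?_ ?_
  · exact Finset.prod_le_prod (fun _ _ => hw _) fun _ _ => hwp _
  · exact Finset.prod_le_prod (fun _ _ => hw _) fun _ _ => hwq _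

/-- The Hellinger affinity of the laws of `n` independent samples is the `n`-th power of the
affinity of the underlying distributions. -/
theorem sum_sqrt_sampleProb {p q : Fin S → ℝ} (hp : ∀ i, 0 ≤ p i) (hq : ∀ i, 0 ≤ q i) :
    ∑ x : Fin n → Fin S, √(sampleProb p x * sampleProb q x) = (∑ j, √(p j * q j)) ^ n := by
  have : ∀ x : Fin n → Fin S,
      √(sampleProb p x * sampleProb q x) = ∏ j, √(p (x j) * q (x j)) := by
    intro x
    rw [sampleProb, sampleProb, ← Finset.prod_mul_distrib,
      Real.sqrt_prod _ fun j _ => mul_nonneg (hp _) (hq _)]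
  simp_rw [this]
  rw [← Fintype.prod_sum (fun (_ : Fin n) (i : Fin S) => √(p i * q i))]
  simp

/-- If the affinity of `p` and `q` falls short of one by at most `t ^ 2 / (2 * n)`, then the laws of
`n` samples are at total variation distance at most `t`. -/
theorem one_sub_le_sum_min_sampleProb {p q : Fin S → ℝ} (hp : p ∈ distributions S)
    (hq : q ∈ distributions S) {t : ℝ} (ht : 0 ≤ t)
    (h : 2 * n * (1 - ∑ j, √(p j * q j)) ≤ t ^ 2) :
    1 - t ≤ ∑ x : Fin n → Fin S, min (sampleProb p x) (sampleProb q x) := by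
  set P : (Fin n → Fin S) → ℝ := sampleProb p with hPdef
  set Q : (Fin n → Fin S) → ℝ := sampleProb q with hQdef
  have hP : ∀ x, 0 ≤ P x := sampleProb_nonneg hp.1
  have hQ : ∀ x, 0 ≤ Q x := sampleProb_nonneg hq.1
  set B := ∑ j, √(p j * q j) with hB
  have hB0 : 0 ≤ B := Finset.sum_nonneg fun _ _ => Real.sqrt_nonneg _
  set M := ∑ x, min (P x) (Q x) with hM
  have hmax : ∑ x, max (P x) (Q x) = 2 - M := by
    have : ∑ x, max (P x) (Q x) + ∑ x, min (P x) (Q x) = ∑ x, P x + ∑ x, Q x := by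
      rw [← Finset.sum_add_distrib, ← Finset.sum_add_distrib]
      exact Finset.sum_congr rfl fun x _ => max_add_min _ _
    rw [sum_sampleProb hp, sum_sampleProb hq] at this
    linarith
  -- Cauchy–Schwarz, as `√(P * Q) = √(min P Q) * √(max P Q)`
  have hcs : (B ^ n) ^ 2 ≤ M * (2 - M) := by
    rw [← hmax, ← sum_sqrt_sampleProb hp.1 hq.1]
    refine Finset.sum_sq_le_sum_mul_sum_of_sq_le_mul _ (fun x _ => le_min (hP x) (hQ x))
      (fun x _ => le_max_of_le_left (hP x)) fun x _ => ?_
    rw [Real.sq_sqrt (mul_nonneg (hP x) (hQ x)), min_mul_max]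
  -- Bernoulli's inequality
  have hbern : 1 + ((n * 2 : ℕ) : ℝ) * (B - 1) ≤ (B ^ n) ^ 2 := by
    have := one_add_mul_le_pow (show (-2 : ℝ) ≤ B - 1 by linarith) (n * 2)
    rwa [add_sub_cancel, pow_mul] at this
  push_cast at hbern
  have : (1 - M) ^ 2 ≤ t ^ 2 := by nlinarith
  linarith [(abs_le.1 (abs_le_of_sq_le_sq this ht)).2]

/-! ### Pairs of symbols -/

/-- The lower bound from `m` disjoint pairs `{i, m + i}` of symbols, each of total mass `1 / m`
put on a single one of its two symbols; the remaining `r` symbols have mass zero. -/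
theorem pow_le_minimaxRisk (n m r : ℕ) (hm : 0 < m) :
    (1 - 1 / (m : ℝ)) ^ n ≤ minimaxRisk (m + (m + r)) n := by
  have hm' : (0 : ℝ) < m := by exact_mod_cast hm
  refine le_minimaxRisk fun est => ?_
  set u : Bool → ℝ := fun b => if b then 1 / (m : ℝ) else 0 with hu
  have hu0 : ∀ b, 0 ≤ u b := by intro b; cases b <;> simp [hu]
  have hu1 : ∀ b, u b + u (!b) = 1 / m := by intro b; cases b <;> simp [hu]
  set p : (Fin m → Bool) → Fin (m + (m + r)) → ℝ := fun σ =>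
    Fin.append (fun i => u (σ i)) (Fin.append (fun i => u (!σ i)) 0) with hpdef
  have hsumm : ∑ _i : Fin m, 1 / (m : ℝ) = 1 := by simp [hm'.ne']
  have hp : ∀ σ, p σ ∈ distributions (m + (m + r)) := by
    intro σ
    constructor
    · intro j
      refine Fin.addCases (fun i => ?_) (fun j => ?_) j
      · simpa [hpdef] using hu0 _
      · refine Fin.addCases (fun i => ?_) (fun i => ?_) j
        · simpa [hpdef] using hu0 _
        · simp [hpdef]
    · rw [Fin.sum_univ_add, Fin.sum_univ_add]
      simp only [hpdef, Fin.append_left, Fin.append_right, Pi.zero_apply, Finset.sum_const_zero,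
        add_zero]
      rw [← Finset.sum_add_distrib, ← hsumm]
      exact Finset.sum_congr rfl fun i _ => hu1 _
  have key := assouad (n := n) p Finset.univ Finset.univ (fun σ _ => hp σ) subset_rfl
    (fun _ _ _ => Finset.mem_univ _)
    (fun i σ q => |u (σ i) - q (Fin.castAdd _ i)| +
      |u (!σ i) - q (Fin.natAdd m (Fin.castAdd r i))|)
    (fun _ _ _ => by positivity) (d := 2 / m) (A := (1 - 1 / (m : ℝ)) ^ n)
    (fun σ q => by
      unfold l1Loss
      rw [Fin.sum_univ_add, Fin.sum_univ_add, Finset.sum_add_distrib]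
      simp only [hpdef, Fin.append_left, Fin.append_right]
      have : 0 ≤ ∑ i : Fin r,
        |(0 : Fin r → ℝ) i - q (Fin.natAdd m (Fin.natAdd m i))| := by positivity
      linarith)
    (by positivity)
    (fun i σ q => by
      have h1 : ∀ b, |u b - u (!b)| = 1 / m := by
        intro b; cases b <;> simp [hu]
      have h2 := abs_sub_le (u (σ i)) (q (Fin.castAdd _ i)) (u (!σ i))
      have h3 := abs_sub_le (u (!σ i)) (q (Fin.natAdd m (Fin.castAdd r i))) (u (σ i))
      rw [abs_sub_comm (q _)] at h2 h3
      rw [abs_sub_comm (u (!σ i)) (u (σ i))] at h3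
      rw [h1] at h2 h3
      simp only [flipBit_same, Bool.not_not]
      have : (2 : ℝ) / m = 1 / m + 1 / m := by ring
      linarith)
    (fun σ _ i => by
      -- neighbouring vectors agree off the pair `i`
      refine le_trans (le_of_eq ?_) (pow_sum_le_sum_min_sampleProb
        (w := Fin.append (fun k => if k = i then 0 else u (σ k))
          (Fin.append (fun k => if k = i then 0 else u (!σ k)) 0)) ?_ ?_ ?_)
      · rw [Fin.sum_univ_add, Fin.sum_univ_add]
        simp only [Fin.append_left, Fin.append_right, Pi.zero_apply, Finset.sum_const_zero,
          add_zero]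
        rw [← Finset.sum_add_distrib]
        congr 1
        have : ∀ k, ((if k = i then 0 else u (σ k)) + if k = i then 0 else u (!σ k)) =
            1 / (m : ℝ) - if k = i then 1 / (m : ℝ) else 0 := by
          intro k
          split_ifs
          · simp
          · rw [hu1]; simp
        simp_rw [this]
        rw [Finset.sum_sub_distrib, hsumm]
        simp
      all_goals
        intro j
        refine Fin.addCases (fun k => ?_) (fun j => ?_) j
        · by_cases h : k = i <;> simp [hpdef, h, hu0, flipBit_of_ne]
        · refine Fin.addCases (fun k => ?_) (fun k => ?_) j
          · by_cases h : k = i <;> simp [hpdef, h, hu0, flipBit_of_ne]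
          · simp [hpdef])
    est
  have h2 : (m : ℝ) * (2 / m * (1 - 1 / (m : ℝ)) ^ n) / 2 = (1 - 1 / (m : ℝ)) ^ n := by
    field_simp
  rw [h2] at key
  simp only [Finset.card_univ, Fintype.card_pi, Fintype.card_bool, Finset.prod_const,
    Fintype.card_fin] at key
  push_cast at key
  rw [mul_comm] at key
  exact le_of_mul_le_mul_left key (by positivity)

/-! ### Random signs -/

/-- The sign `±1` encoded by a bit. -/
def sgn (b : Bool) : ℝ := if b then 1 else -1

theorem sgn_not (b : Bool) : sgn (!b) = -sgn b := by cases b <;> simp [sgn]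

theorem sgn_mul_self (b : Bool) : sgn b * sgn b = 1 := by cases b <;> simp [sgn]

theorem abs_sgn (b : Bool) : |sgn b| = 1 := by cases b <;> simp [sgn]

theorem sum_sgn_flipBit (i : Fin m) (σ : Fin m → Bool) :
    ∑ k, sgn (flipBit i σ k) = ∑ k, sgn (σ k) - 2 * sgn (σ i) := by
  have : ∀ k, sgn (flipBit i σ k) = sgn (σ k) - if k = i then 2 * sgn (σ i) else 0 := by
    intro k
    by_cases h : k = i
    · subst h
      simp [sgn_not]
      ring
    · simp [flipBit_of_ne h, h]
  simp_rw [this, Finset.sum_sub_distrib]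
  simp

theorem sum_sq_sum_sgn (m : ℕ) :
    ∑ σ : Fin m → Bool, (∑ i, sgn (σ i)) ^ 2 = m * 2 ^ m := by
  have hij : ∀ i j : Fin m, ∑ σ : Fin m → Bool, sgn (σ i) * sgn (σ j) =
      if i = j then 2 ^ m else 0 := by
    intro i j
    split_ifs with h
    · subst h
      simp [sgn_mul_self]
    · have := sum_flipBit i fun σ : Fin m → Bool => sgn (σ i) * sgn (σ j)
      simp only [flipBit_same, flipBit_of_ne (Ne.symm h), sgn_not, neg_mul, Finset.sum_neg_distrib]
        at this
      linarith
  simp_rw [sq, Finset.sum_mul_sum]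
  rw [Finset.sum_comm]
  simp_rw [Finset.sum_comm (s := (Finset.univ : Finset (Fin m → Bool))), hij]
  simp

/-- Chebyshev's inequality for a sum of independent signs, as a count of sign patterns. -/
theorem card_sum_sgn_le {T : ℝ} (hT : 0 < T) :
    2 ^ m * (1 - m / T ^ 2) ≤
      ((Finset.univ.filter fun σ : Fin m → Bool => ∑ i, sgn (σ i) ≤ T).card : ℝ) := by
  have hsplit : ((Finset.univ.filter fun σ : Fin m → Bool => ∑ i, sgn (σ i) ≤ T).card : ℝ) +
      ((Finset.univ.filter fun σ : Fin m → Bool => ¬ ∑ i, sgn (σ i) ≤ T).card : ℝ) = 2 ^ m := by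
    have := Finset.card_filter_add_card_filter_not (s := (Finset.univ : Finset (Fin m → Bool)))
      (fun σ => ∑ i, sgn (σ i) ≤ T)
    simp only [Finset.card_univ, Fintype.card_pi, Fintype.card_bool, Finset.prod_const,
      Fintype.card_fin] at this
    exact_mod_cast this
  have hcheb : ((Finset.univ.filter fun σ : Fin m → Bool => ¬ ∑ i, sgn (σ i) ≤ T).card : ℝ) *
      T ^ 2 ≤ m * 2 ^ m := by
    rw [← sum_sq_sum_sgn, ← nsmul_eq_mul]
    refine (Finset.card_nsmul_le_sum _ (fun σ : Fin m → Bool => (∑ i, sgn (σ i)) ^ 2) _ ?_).trans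
      (Finset.sum_le_univ_sum_of_nonneg fun _ => sq_nonneg _)
    intro σ hσ
    have := (Finset.mem_filter.1 hσ).2
    push Not at this
    exact pow_le_pow_left₀ hT.le this.le 2
  rw [← le_div_iff₀ (by positivity)] at hcheb
  have : (2 : ℝ) ^ m * (1 - m / T ^ 2) = 2 ^ m - m * 2 ^ m / T ^ 2 := by ring
  linarith

/-! ### Perturbed uniform distributions with a buffer symbol -/

theorem half_add_sub_le_sqrt_mul {b c β : ℝ} (hβ : 0 < β) (hb : β ≤ b) (hc : β ≤ c) :
    (b + c) / 2 - (b - c) ^ 2 / (8 * β) ≤ √(b * c) := by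
  have hb0 : 0 ≤ b := hβ.le.trans hb
  have hc0 : 0 ≤ c := hβ.le.trans hc
  rw [Real.sqrt_mul hb0]
  set u := √b with hu
  set v := √c with hv
  have hbu : b = u ^ 2 := (Real.sq_sqrt hb0).symm
  have hcv : c = v ^ 2 := (Real.sq_sqrt hc0).symm
  have hs : √β ^ 2 = β := Real.sq_sqrt hβ.le
  have hus : √β ≤ u := Real.sqrt_le_sqrt hb
  have hvs : √β ≤ v := Real.sqrt_le_sqrt hc
  -- with `b = u²` and `c = v²`, the left side is `(u² + v²) / 2 - (u - v)² (u + v)² / (8β)`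
  have huv : 4 * β ≤ (u + v) ^ 2 := by
    have := Real.sqrt_nonneg β
    nlinarith
  have h : (u - v) ^ 2 / 2 ≤ (b - c) ^ 2 / (8 * β) := by
    rw [le_div_iff₀ (by positivity), hbu, hcv]
    nlinarith [mul_le_mul_of_nonneg_left huv (sq_nonneg (u - v))]
  rw [hbu, hcv] at h ⊢
  linarith

/-- The vector with entries `a * (1 ± η)`, the signs given by `σ`, at the first `m` symbols, and
with the mass that is missing to one at the last symbol, the buffer. For general parameters the
buffer may be negative. -/
def perturbed (a η : ℝ) (σ : Fin m → Bool) : Fin (m + 1) → ℝ :=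
  Fin.snoc (α := fun _ => ℝ) (fun i => a * (1 + η * sgn (σ i))) (1 - a * (m + η * ∑ i, sgn (σ i)))

theorem perturbed_mem {a η : ℝ} (ha : 0 ≤ a) (hη0 : 0 ≤ η) (hη : η ≤ 1) {σ : Fin m → Bool}
    (h : a * (m + η * ∑ i, sgn (σ i)) ≤ 1) : perturbed a η σ ∈ distributions (m + 1) := by
  constructor
  · intro j
    refine Fin.lastCases ?_ (fun i => ?_) j
    · simpa [perturbed] using h
    · simp only [perturbed, Fin.snoc_castSucc]
      refine mul_nonneg ha ?_
      cases σ i <;> simp [sgn] <;> linarith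
  · rw [Fin.sum_univ_castSucc]
    simp only [perturbed, Fin.snoc_castSucc, Fin.snoc_last]
    rw [← Finset.mul_sum, Finset.sum_add_distrib, ← Finset.mul_sum]
    simp

/-- The affinity of neighbouring perturbed vectors whose buffers are at least `β`: the flipped
symbol contributes the first term on the right and the buffer the second. -/
theorem affinity_perturbed {a η β : ℝ} (ha : 0 ≤ a) (hη0 : 0 ≤ η) (hη : η ≤ 1) (hβ : 0 < β)
    {σ : Fin m → Bool} {i : Fin m} (h : a * (m + η * ∑ k, sgn (σ k)) + β ≤ 1)
    (h' : a * (m + η * ∑ k, sgn (flipBit i σ k)) + β ≤ 1) :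
    1 - ∑ j, √(perturbed a η σ j * perturbed a η (flipBit i σ) j) ≤
      a * (1 - √(1 - η ^ 2)) + (η * a) ^ 2 / (2 * β) := by
  have hbuf := half_add_sub_le_sqrt_mul (b := 1 - a * (m + η * ∑ k, sgn (σ k)))
    (c := 1 - a * (m + η * ∑ k, sgn (flipBit i σ k))) hβ (by linarith) (by linarith)
  rw [Fin.sum_univ_castSucc]
  simp only [perturbed, Fin.snoc_castSucc, Fin.snoc_last]
  have hterm : ∀ k, √(a * (1 + η * sgn (σ k)) * (a * (1 + η * sgn (flipBit i σ k)))) =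
      a * (1 + η * sgn (σ k)) +
        if k = i then a * √(1 - η ^ 2) - a * (1 + η * sgn (σ i)) else 0 := by
    intro k
    by_cases hk : k = i
    · subst hk
      have : a * (1 + η * sgn (σ k)) * (a * (1 + η * sgn (flipBit k σ k))) =
          a ^ 2 * (1 - η ^ 2) := by
        rw [flipBit_same, sgn_not]
        linear_combination (-a ^ 2 * η ^ 2) * sgn_mul_self (σ k)
      rw [this, Real.sqrt_mul (sq_nonneg a), Real.sqrt_sq ha]
      simp
    · rw [flipBit_of_ne hk, Real.sqrt_mul_self]
      · simp [hk]
      · refine mul_nonneg ha ?_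
        cases σ k <;> simp [sgn] <;> linarith
  simp_rw [hterm]
  rw [Finset.sum_add_distrib, ← Finset.mul_sum, Finset.sum_add_distrib, ← Finset.mul_sum]
  simp only [Finset.sum_const, Finset.card_univ, Fintype.card_fin, nsmul_eq_mul, mul_one,
    Finset.sum_ite_eq', Finset.mem_univ, if_true]
  rw [sum_sgn_flipBit] at hbuf ⊢
  set K := ∑ k, sgn (σ k)
  have h3 : (1 - a * (m + η * K) - (1 - a * (m + η * (K - 2 * sgn (σ i))))) ^ 2 / (8 * β) =
      (η * a) ^ 2 / (2 * β) := by
    have : (1 - a * (m + η * K) - (1 - a * (m + η * (K - 2 * sgn (σ i))))) ^ 2 =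
        4 * (η * a) ^ 2 := by
      linear_combination (4 * a ^ 2 * η ^ 2) * sgn_mul_self (σ i)
    rw [this]
    field_simp
    ring
  rw [h3] at hbuf
  linarith

/-- The lower bound from the perturbed vectors. The buffer is at least `β` when the signs add up
to at most `T + 2`, which holds for all neighbours of the patterns with sum at most `T`. The bound
`t` is on the total variation distance of the laws of the sample under neighbours. -/
theorem perturbed_le_minimaxRisk {a η β T t : ℝ} (ha : 0 ≤ a) (hη0 : 0 ≤ η) (hη : η ≤ 1)
    (hβ : 0 < β) (hT : 0 < T) (hmass : a * (m + η * (T + 2)) + β ≤ 1) (ht0 : 0 ≤ t) (ht1 : t ≤ 1)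
    (ht : 2 * n * (a * (1 - √(1 - η ^ 2)) + (η * a) ^ 2 / (2 * β)) ≤ t ^ 2) :
    m * (η * a) * (1 - t) * (1 - m / T ^ 2) ≤ minimaxRisk (m + 1) n := by
  refine le_minimaxRisk fun est => ?_
  set C := Finset.univ.filter fun σ : Fin m → Bool => ∑ i, sgn (σ i) ≤ T with hC
  set G := Finset.univ.filter fun σ : Fin m → Bool => ∑ i, sgn (σ i) ≤ T + 2 with hG
  have hbuf : ∀ σ ∈ G, a * (m + η * ∑ k, sgn (σ k)) + β ≤ 1 := by
    intro σ hσ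
    have := (Finset.mem_filter.1 hσ).2
    have : a * (m + η * ∑ k, sgn (σ k)) ≤ a * (m + η * (T + 2)) := by gcongr
    linarith
  have hp : ∀ σ ∈ G, perturbed a η σ ∈ distributions (m + 1) := fun σ hσ =>
    perturbed_mem ha hη0 hη (by linarith [hbuf σ hσ])
  have hCG : C ⊆ G := by
    intro σ hσ
    have := (Finset.mem_filter.1 hσ).2
    exact Finset.mem_filter.2 ⟨Finset.mem_univ _, by linarith⟩
  have hflip : ∀ σ ∈ C, ∀ i, flipBit i σ ∈ G := by
    intro σ hσ i
    have := (Finset.mem_filter.1 hσ).2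
    refine Finset.mem_filter.2 ⟨Finset.mem_univ _, ?_⟩
    rw [sum_sgn_flipBit]
    have := (abs_le.1 (abs_sgn (σ i)).le).1
    linarith
  have key := assouad (n := n) (perturbed a η) G C hp hCG hflip
    (fun i σ q => |a * (1 + η * sgn (σ i)) - q i.castSucc|) (fun _ _ _ => abs_nonneg _)
    (d := 2 * (η * a)) (A := 1 - t)
    (fun σ q => by
      unfold l1Loss
      rw [Fin.sum_univ_castSucc]
      simp only [perturbed, Fin.snoc_castSucc]
      exact le_add_of_nonneg_right (abs_nonneg _))
    (by positivity)
    (fun i σ q => by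
      have h1 := abs_sub_le (a * (1 + η * sgn (σ i))) (q i.castSucc)
        (a * (1 + η * sgn (flipBit i σ i)))
      rw [abs_sub_comm (q _)] at h1
      have h2 : |a * (1 + η * sgn (σ i)) - a * (1 + η * sgn (flipBit i σ i))| = 2 * (η * a) := by
        rw [flipBit_same, sgn_not]
        have : a * (1 + η * sgn (σ i)) - a * (1 + η * -sgn (σ i)) = 2 * (η * a) * sgn (σ i) := by
          ring
        rw [this, abs_mul, abs_sgn, mul_one, abs_of_nonneg (by positivity)]
      linarith)
    (fun σ hσ i => one_sub_le_sum_min_sampleProb (hp _ (hCG hσ)) (hp _ (hflip σ hσ i)) ht0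
      (le_trans (mul_le_mul_of_nonneg_left
        (affinity_perturbed ha hη0 hη hβ (hbuf _ (hCG hσ)) (hbuf _ (hflip σ hσ i)))
        (by positivity)) ht))
    est
  have h1 := card_sum_sgn_le (m := m) hT
  have h2 : 0 ≤ m * (η * a) * (1 - t) := mul_nonneg (by positivity) (by linarith)
  have h3 := mul_le_mul_of_nonneg_left h1 h2
  rw [← hC] at h3
  refine le_of_mul_le_mul_left (a := (2 : ℝ) ^ m) ?_ (by positivity)
  calc (2 : ℝ) ^ m * (m * (η * a) * (1 - t) * (1 - m / T ^ 2))
      = m * (η * a) * (1 - t) * (2 ^ m * (1 - m / T ^ 2)) := by ring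
    _ ≤ m * (η * a) * (1 - t) * C.card := h3
    _ = m * (2 * (η * a) * (1 - t)) / 2 * C.card := by ring
    _ ≤ _ := key

/-! ### Numerical bounds -/

/-- A bound on the exponential at a rational number, reduced to arithmetic. -/
theorem exp_div_le {p q : ℕ} (hq : q ≠ 0) {y : ℝ} (hy : 0 ≤ y)
    (h : (2.7182818286 : ℝ) ^ p ≤ y ^ q) : Real.exp (p / q) ≤ y := by
  refine le_of_pow_le_pow_left₀ hq hy ?_
  rw [← Real.exp_nat_mul, mul_div_cancel₀ _ (by exact_mod_cast hq), ← Real.exp_one_pow]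
  exact (pow_le_pow_left₀ (Real.exp_nonneg 1) Real.exp_one_lt_d9.le p).trans h

/-- If the last error term is below one, then `ζ² S > 76.8 (ln S)²`, as `exp 2.4 < 12`. Since
`ζ² S ≤ S`, each lower bound on `S` improves itself: it gives one on `ln S`, hence one on `ζ² S`. -/
theorem le_sq_mul_of_error_lt_one {S ζ : ℝ} (hS : 2 ≤ S) (hζ : ζ ∈ Set.Ioc (0 : ℝ) 1)
    (h : 12 * Real.exp (-(ζ ^ 2 * S / (32 * Real.log S ^ 2))) < 1) : 4915 ≤ ζ ^ 2 * S := by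
  have hL2 : (0.69 : ℝ) ≤ Real.log S := by
    have := Real.log_le_log two_pos hS
    linarith [Real.log_two_gt_d9]
  have hSζ : ζ ^ 2 * S ≤ S :=
    mul_le_of_le_one_left (by linarith) (pow_le_one₀ hζ.1.le hζ.2)
  have hkey : 76.8 * Real.log S ^ 2 ≤ ζ ^ 2 * S := by
    by_contra! hlt
    have hx : ζ ^ 2 * S / (32 * Real.log S ^ 2) ≤ (12 : ℕ) / (5 : ℕ) := by
      rw [div_le_iff₀ (by positivity)]
      push_cast
      linarith
    have h12 : Real.exp (ζ ^ 2 * S / (32 * Real.log S ^ 2)) ≤ 12 :=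
      (Real.exp_le_exp.2 hx).trans (exp_div_le (by norm_num) (by norm_num) (by norm_num))
    rw [Real.exp_neg, ← div_eq_mul_inv, div_lt_one (Real.exp_pos _)] at h
    linarith
  have step : ∀ {c y : ℝ}, 0 ≤ c → Real.exp c ≤ y → y ≤ S → 76.8 * c ^ 2 ≤ ζ ^ 2 * S := by
    intro c y hc hcy hyS
    have : c ≤ Real.log S := (Real.le_log_iff_exp_le (by linarith)).2 (hcy.trans hyS)
    exact le_trans (by gcongr) hkey
  have h1 : 36 ≤ S := by nlinarith
  have h2 := step (c := (7 : ℕ) / (2 : ℕ)) (by positivity)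
    (exp_div_le (y := 36) (by norm_num) (by norm_num) (by norm_num)) h1
  norm_num at h2
  have h3 := step (c := (34 : ℕ) / (5 : ℕ)) (by positivity)
    (exp_div_le (y := 940) (by norm_num) (by norm_num) (by norm_num)) (by linarith)
  norm_num at h3
  have h4 := step (c := (8 : ℕ) / (1 : ℕ)) (by positivity)
    (exp_div_le (y := 3551) (by norm_num) (by norm_num) (by norm_num)) (by linarith)
  norm_num at h4
  linarith

theorem exp_neg_le_minimaxRisk {S n : ℕ} {ζ : ℝ} (hζ : ζ ∈ Set.Ioc (0 : ℝ) 1)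
    (hS : 4915 ≤ ζ ^ 2 * S) :
    Real.exp (-(2 * (1 + ζ) * n / S)) ≤ minimaxRisk S n := by
  have hζS : 4915 ≤ ζ * (S : ℝ) := hS.trans (by
    have := hζ.1; have := hζ.2
    gcongr
    nlinarith)
  have hS' : (4915 : ℝ) ≤ S := hζS.trans (mul_le_of_le_one_left (by positivity) hζ.2)
  obtain ⟨m, r, hr, hSm⟩ : ∃ m r, r < 2 ∧ S = m + (m + r) :=
    ⟨S / 2, S % 2, Nat.mod_lt _ two_pos, by omega⟩
  have hm2 : (S : ℝ) - 1 ≤ 2 * m := by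
    have : S ≤ 2 * m + 1 := by omega
    have : (S : ℝ) ≤ 2 * m + 1 := by exact_mod_cast this
    linarith
  have hm1 : (1 : ℝ) < m := by linarith
  have hbase : Real.exp (-(2 * (1 + ζ) / S)) ≤ 1 - 1 / (m : ℝ) := by
    have h1 : (1 - 1 / (m : ℝ))⁻¹ ≤ Real.exp (2 * (1 + ζ) / S) := by
      have h2 : (1 - 1 / (m : ℝ))⁻¹ = 1 / (m - 1) + 1 := by
        have : (m : ℝ) - 1 ≠ 0 := by linarith
        field_simp
        ring
      rw [h2]
      refine le_trans ?_ (Real.add_one_le_exp _)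
      have : 1 / ((m : ℝ) - 1) ≤ 2 * (1 + ζ) / S := by
        rw [div_le_div_iff₀ (by linarith) (by linarith)]
        nlinarith [hζ.1, hζ.2]
      linarith
    rw [Real.exp_neg]
    refine inv_le_of_inv_le₀ ?_ h1
    rw [sub_pos, div_lt_one (by linarith)]
    exact hm1
  have h := pow_le_minimaxRisk n m r (by exact_mod_cast (zero_lt_one.trans hm1))
  rw [← hSm] at h
  refine le_trans ?_ h
  refine le_trans (le_of_eq ?_) (pow_le_pow_left₀ (Real.exp_nonneg _) hbase n)
  rw [← Real.exp_nat_mul]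
  congr 1
  ring

theorem sqrt_le_exp_neg {x : ℝ} (h1 : Real.exp 1 / 16 < x) (h2 : x ≤ 1 / 2) :
    1 / 8 * √(Real.exp 1 / x) ≤ Real.exp (-(2 * x)) := by
  have he := Real.exp_one_gt_d9
  have hx : 0 < x := by linarith
  -- the inequality holds with little room on the whole range, so it is checked on two pieces
  have key : Real.exp (1 + 4 * x) ≤ 64 * x := by
    rcases le_total x (1 / 3) with h | h
    · have h4 : Real.exp ((4 : ℕ) / (3 : ℕ)) ≤ 4 :=
        exp_div_le (by norm_num) (by norm_num) (by norm_num)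
      calc Real.exp (1 + 4 * x) ≤ Real.exp (1 + (4 : ℕ) / (3 : ℕ)) := by
            gcongr
            push_cast
            linarith
        _ = Real.exp 1 * Real.exp ((4 : ℕ) / (3 : ℕ)) := Real.exp_add _ _
        _ ≤ Real.exp 1 * 4 := by gcongr
        _ ≤ 64 * x := by linarith
    · have h3 : Real.exp ((3 : ℕ) / (1 : ℕ)) ≤ 64 / 3 :=
        exp_div_le (by norm_num) (by norm_num) (by norm_num)
      calc Real.exp (1 + 4 * x) ≤ Real.exp ((3 : ℕ) / (1 : ℕ)) := by
            gcongr
            push_cast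
            linarith
        _ ≤ 64 * x := by linarith
  have hsq : Real.exp 1 / x ≤ (8 * Real.exp (-(2 * x))) ^ 2 := by
    have h4 : (8 * Real.exp (-(2 * x))) ^ 2 = 64 / Real.exp (4 * x) := by
      rw [mul_pow, ← Real.exp_nat_mul, div_eq_mul_inv, ← Real.exp_neg]
      norm_num
      ring
    rw [h4, div_le_div_iff₀ hx (Real.exp_pos _), ← Real.exp_add]
    exact key
  have := Real.sqrt_le_sqrt hsq
  rw [Real.sqrt_sq (by positivity)] at this
  linarith

theorem one_sub_sqrt_one_sub_le {y : ℝ} (h0 : 0 ≤ y) (h1 : y ≤ 9 / 25) :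
    1 - √(1 - y) ≤ 5 / 9 * y := by
  have : 1 - 5 / 9 * y ≤ √(1 - y) := Real.le_sqrt_of_sq_le (by nlinarith)
  linarith

/-- The perturbed vectors with `a = 1 / (S * (1 + ζ / 16))`, buffer at least `40 * a` and the
threshold `6 * √S` for the sum of the signs. The laws of the sample under neighbours are at total
variation distance at most `0.44`, and `0.94 * (1 - 0.44) * (35 / 36) > 1 / 2`. -/
theorem half_le_minimaxRisk {S n : ℕ} {ζ η : ℝ} (hζ : ζ ∈ Set.Ioc (0 : ℝ) 1)
    (hS : 4915 ≤ ζ ^ 2 * S) (hη0 : 0 ≤ η) (hη : η ^ 2 ≤ 0.34) (hn : n * η ^ 2 ≤ 0.17 * S) :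
    η / 2 ≤ minimaxRisk S n := by
  obtain ⟨hζ0, hζ1⟩ := hζ
  have hS' : (4915 : ℝ) ≤ S := hS.trans
    (mul_le_of_le_one_left (by positivity) (pow_le_one₀ hζ0.le hζ1))
  obtain ⟨m, rfl⟩ : ∃ m, S = m + 1 :=
    Nat.exists_eq_succ_of_ne_zero (by rintro rfl; norm_num at hS')
  obtain ⟨N, hN⟩ : ∃ N : ℝ, N = ((m + 1 : ℕ) : ℝ) := ⟨_, rfl⟩
  rw [← hN] at hS hS' hn
  have hmN : (m : ℝ) = N - 1 := by rw [hN]; push_cast; ring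
  have hN0 : 0 < N := by linarith
  obtain ⟨s, hs0, hs2⟩ : ∃ s : ℝ, 0 ≤ s ∧ s ^ 2 = N :=
    ⟨√N, Real.sqrt_nonneg _, Real.sq_sqrt hN0.le⟩
  have hζs : 70 ≤ ζ * s := by
    refine le_of_sq_le_sq ?_ (by positivity)
    rw [mul_pow, hs2]
    linarith
  have hs70 : 70 ≤ s := hζs.trans (mul_le_of_le_one_left hs0 hζ1)
  have hη6 : η ≤ 0.6 := by
    refine le_of_sq_le_sq ?_ (by norm_num)
    linarith
  obtain ⟨a, ha⟩ : ∃ a : ℝ, a = 1 / (N * (1 + ζ / 16)) := ⟨_, rfl⟩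
  have ha0 : 0 < a := by rw [ha]; positivity
  have haN : a * (N * (1 + ζ / 16)) = 1 := by rw [ha]; field_simp
  have haN1 : a * N ≤ 1 := by
    rw [← haN]
    gcongr
    exact le_mul_of_one_le_right hN0.le (by linarith)
  have hna : n * a * η ^ 2 ≤ 0.17 := by
    calc n * a * η ^ 2 = a * (n * η ^ 2) := by ring
      _ ≤ a * (0.17 * N) := by gcongr
      _ = 0.17 * (a * N) := by ring
      _ ≤ 0.17 * 1 := by gcongr
      _ = 0.17 := by norm_num
  have hmass : a * (m + η * (6 * s + 2)) + 40 * a ≤ 1 := by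
    have h1 : N - 1 + η * (6 * s + 2) + 40 ≤ N * (1 + ζ / 16) := by
      have h2 : η * (6 * s + 2) ≤ 0.6 * (6 * s + 2) := by gcongr
      -- the excess `ζ N / 16 ≥ (70 / 16) * s` exceeds the fluctuation `3.6 * s` of the total mass
      have h3 : 70 * s ≤ ζ * N := by
        rw [← hs2, sq, ← mul_assoc]
        gcongr
      linarith
    calc a * (m + η * (6 * s + 2)) + 40 * a = a * (N - 1 + η * (6 * s + 2) + 40) := by
          rw [hmN]; ring
      _ ≤ a * (N * (1 + ζ / 16)) := by gcongr
      _ = 1 := haN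
  have ht : 2 * n * (a * (1 - √(1 - η ^ 2)) + (η * a) ^ 2 / (2 * (40 * a))) ≤ 0.44 ^ 2 := by
    have h1 : (η * a) ^ 2 / (2 * (40 * a)) = a * (η ^ 2 / 80) := by
      field_simp
      ring
    rw [h1]
    calc 2 * n * (a * (1 - √(1 - η ^ 2)) + a * (η ^ 2 / 80))
        ≤ 2 * n * (a * (5 / 9 * η ^ 2) + a * (η ^ 2 / 80)) := by
          gcongr
          exact one_sub_sqrt_one_sub_le (sq_nonneg η) (by linarith)
      _ = n * a * η ^ 2 * (10 / 9 + 1 / 40) := by ring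
      _ ≤ 0.17 * (10 / 9 + 1 / 40) := by gcongr
      _ ≤ 0.44 ^ 2 := by norm_num
  have key := perturbed_le_minimaxRisk (m := m) (n := n) (a := a) (η := η) (β := 40 * a)
    (T := 6 * s) (t := 0.44) ha0.le hη0 (by linarith) (by linarith) (by linarith) hmass
    (by norm_num) (by norm_num) ht
  refine le_trans ?_ key
  have hfrac : (35 / 36 : ℝ) ≤ 1 - m / (6 * s) ^ 2 := by
    have : (m : ℝ) / (6 * s) ^ 2 ≤ 1 / 36 := by
      rw [mul_pow, hs2, hmN, div_le_div_iff₀ (by positivity) (by norm_num)]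
      linarith
    linarith
  have hma : 0.94 ≤ m * a := by
    rw [ha, hmN, mul_one_div, le_div_iff₀ (by positivity)]
    nlinarith
  calc η / 2 ≤ 0.94 * η * (1 - 0.44) * (35 / 36) := by linarith
    _ ≤ m * a * η * (1 - 0.44) * (1 - m / (6 * s) ^ 2) := by gcongr
    _ = _ := by ring

theorem sqrt_le_minimaxRisk {S n : ℕ} {ζ : ℝ} (hζ : ζ ∈ Set.Ioc (0 : ℝ) 1)
    (hS : 4915 ≤ ζ ^ 2 * S) (hx : 1 / 2 ≤ (1 + ζ) * n / S) :
    1 / 8 * √(Real.exp 1 * S / ((1 + ζ) * n)) ≤ minimaxRisk S n := by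
  have hS0 : (0 : ℝ) < S := by
    have := hζ.1
    exact pos_of_mul_pos_right (lt_of_lt_of_le (by norm_num) hS) (by positivity)
  have hn0 : (0 : ℝ) < n := by
    rcases Nat.eq_zero_or_pos n with h | h
    · subst h; norm_num at hx
    · exact_mod_cast h
  have hζ0 := hζ.1
  have he := Real.exp_one_lt_d9
  rw [div_le_div_iff₀ two_pos hS0] at hx
  have hη2 : (1 / 4 * √(Real.exp 1 * S / ((1 + ζ) * n))) ^ 2 =
      Real.exp 1 * S / (16 * ((1 + ζ) * n)) := by
    rw [mul_pow, Real.sq_sqrt (by positivity)]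
    field_simp
    norm_num
  have h := half_le_minimaxRisk (n := n) (η := 1 / 4 * √(Real.exp 1 * S / ((1 + ζ) * n)))
    hζ hS (by positivity)
    (by
      rw [hη2, div_le_iff₀ (by positivity)]
      have : Real.exp 1 * S ≤ 2.72 * S := by gcongr; linarith
      linarith)
    (by
      have h1 : n * (Real.exp 1 * S / (16 * ((1 + ζ) * n))) =
          Real.exp 1 / 16 * S / (1 + ζ) := by field_simp
      rw [hη2, h1]
      refine (div_le_self (by positivity) (by linarith)).trans ?_
      gcongr
      linarith)
  linarith

end DiscreteEstimation

end

theorem theorem2 (S n : ℕ) (hS : 2 ≤ S) (hn : 1 ≤ n) (ζ : ℝ) (hζ : ζ ∈ Set.Ioc (0 : ℝ) 1) :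
    (1 / 8) * Real.sqrt (Real.exp 1 * (S : ℝ) / ((1 + ζ) * (n : ℝ)))
          * (if (1 + ζ) * (n : ℝ) / (S : ℝ) > Real.exp 1 / 16 then (1 : ℝ) else 0)
        + Real.exp (-(2 * (1 + ζ) * (n : ℝ) / (S : ℝ)))
          * (if (1 + ζ) * (n : ℝ) / (S : ℝ) ≤ Real.exp 1 / 16 then (1 : ℝ) else 0)
        - Real.exp (-(ζ ^ 2 * (n : ℝ) / 24))
        - 12 * Real.exp (-(ζ ^ 2 * (S : ℝ) / (32 * (Real.log (S : ℝ)) ^ 2)))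
      ≤ DiscreteEstimation.minimaxRisk S n := by
  have hS' : (2 : ℝ) ≤ S := by exact_mod_cast hS
  have hn' : (1 : ℝ) ≤ n := by exact_mod_cast hn
  have hζ0 := hζ.1
  set x := (1 + ζ) * (n : ℝ) / (S : ℝ) with hx
  have hx0 : 0 < x := by positivity
  have hdiv : Real.exp 1 * (S : ℝ) / ((1 + ζ) * (n : ℝ)) = Real.exp 1 / x := by
    rw [hx]
    field_simp
  have hexp : 2 * (1 + ζ) * (n : ℝ) / (S : ℝ) = 2 * x := by rw [hx]; ring
  have hpos := Real.exp_pos (-(ζ ^ 2 * (n : ℝ) / 24))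
  have herr := Real.exp_pos (-(ζ ^ 2 * (S : ℝ) / (32 * (Real.log (S : ℝ)) ^ 2)))
  -- the main term is at most one, so the claim is trivial unless the last error is below one
  rcases lt_or_ge (12 * Real.exp (-(ζ ^ 2 * (S : ℝ) / (32 * (Real.log (S : ℝ)) ^ 2)))) 1
    with hlt | hge
  · have hbig := DiscreteEstimation.le_sq_mul_of_error_lt_one hS' hζ hlt
    have hA := DiscreteEstimation.exp_neg_le_minimaxRisk (n := n) hζ hbig
    rw [hexp] at hA
    rcases le_or_gt x (Real.exp 1 / 16) with h | h
    · rw [if_neg (not_lt.2 h), if_pos h, hexp]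
      linarith
    · rw [if_pos h, if_neg (not_le.2 h)]
      rcases le_total x (1 / 2) with h2 | h2
      · have := DiscreteEstimation.sqrt_le_exp_neg h h2
        rw [hdiv]
        linarith
      · have := DiscreteEstimation.sqrt_le_minimaxRisk hζ hbig h2
        linarith
  · have h0 := DiscreteEstimation.minimaxRisk_nonneg (S := S) (n := n)
    rcases le_or_gt x (Real.exp 1 / 16) with h | h
    · rw [if_neg (not_lt.2 h), if_pos h, hexp]
      have : Real.exp (-(2 * x)) ≤ 1 := Real.exp_le_one_iff.2 (by linarith)
      linarith
    · rw [if_pos h, if_neg (not_le.2 h), hdiv]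
      have : √(Real.exp 1 / x) ≤ 4 := by
        rw [Real.sqrt_le_left (by norm_num), div_le_iff₀ hx0]
        linarith
      linarith
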